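/- Let $d\ge 1$, let $\Omega\subset\mathbb R^d$ be a bounded open set (for instance a bounded domain with Lipschitz boundary), and let $\tau>0$. Let $\lambda_1\le\lambda_2\le\cdots$ be the Dirichlet eigenvalues of $-\Delta$ on $\Omega$, counted with multiplicity, and let $(\varphi_n)_{n\ge1}$ be an orthonormal basis of $L^2(\Omega)$ of corresponding eigenfunctions: $0\ne\varphi_n\in H^1_0(\Omega)$ and $-\Delta\varphi_n=\lambda_n\varphi_n$ weakly. Write $\|\cdot\|$ and $\langle\cdot,\cdot\rangle$ for the norm and inner product of $L^2(\Omega)$, and for $p\ge 0$ put $$\mathbb H_p=\Big\{g\in L^2(\Omega):\ \sum_n\lambda_n^{2p}|\langle g,\varphi_n\rangle|^2<\infty\Big\},\qquad S_{\varrho,p}=\Big\{g\in \mathbb H_p:\ \sum_n\lambda_n^{2p}|\langle g,\varphi_n\rangle|^2\le\varrho^2\Big\}.$$ Let $\psi\in C([0,\tau])$ be such that there are $\tau_0\in[0,\tau)$ and $\kappa_1>0$ with $|\psi|\ge\kappa_1$ on $[\tau_0,\tau]$, and such that either $\psi$ does not change sign on $[0,\tau]$, or $\psi$ is differentiable on $[0,\tau]$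 with $|\psi'|\le\kappa_2$ for some $\kappa_2>0$ and $|\psi(t)|\le\frac{(\tau-\tau_0)^2\kappa_1}{4\tau\tau_0}$ for all $t\in[0,\tau]$ with $\psi(t)\psi(\tau)\le0$. Put $$\mu_n(t)=\int_0^te^{-\lambda_n(t-s)}(t-s)\psi(s)\,ds,\qquad \mu_n=\mu_n(\tau).$$ Let $b\ge2$ and $\alpha>0$. For $\tilde f\in\mathbb H_{b-2}$, the mild solution of the quasi-reversibility problem $$v_{tt}-2\Delta v_t+\Delta^2v=(I+\alpha(-\Delta)^b)\psi(t)\tilde f\ \text{ in }\Omega\times(0,\tau),\quad v=\Delta v=0\ \text{ on }\partial\Omega\times(0,\tau),\quad v(0)=v_t(0)=0$$ is the function $v\in C([0,\tau];L^2(\Omega))$ with $v(t)=\sum_n(1+\alpha\lambda_n^b)\mu_n(t)\langle\tilde f,\varphi_n\rangle\varphi_n$. In particular $v(\tau)=\mathbb T_\alpha\tilde f:=\sum_n(1+\alpha\lambda_n^b)\mu_n\langle\tilde f,\varphi_n\rangle\varphi_n$. **Theorem.** There is a constant $C>0$ with $|\mu_n|\ge C/\lambda_n^2$ for all $n$. For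 every $b\ge2$, $\alpha>0$ and $g\in L^2(\Omega)$ there is exactly one $\tilde f\in\mathbb H_{b-2}$ whose mild solution $v$ satisfies $v(\tau)=g$; it is denoted by $\mathbb T_\alpha^{-1}g$. Let $C>0$ be any constant with $|\mu_n|\ge C/\lambda_n^2$ for all $n$. Let $b\ge2$ and $\alpha,\delta,\varrho,p>0$, let $f\in S_{\varrho,p}$, and let $h=u(\tau)$ be the final value of a weak solution $u\in C([0,\tau];L^2(\Omega))$ of $$u_{tt}-2\Delta u_t+\Delta^2u=\psi(t)f(x)\ \text{ in }\Omega\times(0,\tau),\quad u=\Delta u=0\ \text{ on }\partial\Omega\times(0,\tau),\quad u(0)=u_t(0)=0,$$ where the equation is tested with the Dirichlet eigenfunctions of $-\Delta$. Let $h^\delta\in L^2(\Omega)$ with $\|h-h^\delta\|\le\delta$, and put $f_\alpha=\mathbb T_\alpha^{-1}h$, $f_\alpha^\delta=\mathbb T_\alpha^{-1}h^\delta$. Then: (i) $\displaystyle \|f_\alpha-f_\alpha^\delta\|\le\frac1C\,\frac{\delta}{\alpha^{2/b}}$; (ii) if $0<p<b$, then $\displaystyle \|f-f_\alpha\|\le\frac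 pb\Big(\frac{b-p}{p}\Big)^{\frac{b-p}{b}}\varrho\,\alpha^{p/b}$, and if $p\ge b$, then $\|f-f_\alpha\|\le\lambda_1^{\,b-p}\,\varrho\,\alpha$. -/

import Mathlib

open MeasureTheory Set Filter Topology
open scoped ContDiff ENNReal

noncomputable section

namespace BiParabolic

/-- The space `L²(Ω)` of real functions on a subset `Ω` of Euclidean space `ℝᵈ`. -/
abbrev L2 {d : ℕ} (Ω : Set (EuclideanSpace ℝ (Fin d))) : Type :=
  Lp ℝ 2 (volume.restrict Ω)

/-- `v ∈ C_c^∞(Ω)`. -/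
def IsTestFunction {d : ℕ} (Ω : Set (EuclideanSpace ℝ (Fin d)))
    (v : EuclideanSpace ℝ (Fin d) → ℝ) : Prop :=
  ContDiff ℝ ∞ v ∧ HasCompactSupport v ∧ tsupport v ⊆ Ω

/-- `w ∈ H¹₀(Ω)` with weak gradient `G ∈ L²(Ω)ᵈ`: the pair `(w, G)` is a limit in `L²` of pairs
`(v, ∇v)` with `v ∈ C_c^∞(Ω)`. -/
def HasH10Gradient {d : ℕ} (Ω : Set (EuclideanSpace ℝ (Fin d))) (w : L2 Ω)
    (G : Lp (EuclideanSpace ℝ (Fin d)) 2 (volume.restrict Ω)) : Prop :=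
  ∃ v : ℕ → EuclideanSpace ℝ (Fin d) → ℝ,
    (∀ k, IsTestFunction Ω (v k)) ∧
    Tendsto (fun k => eLpNorm (fun x => v k x - w x) 2 (volume.restrict Ω)) atTop (𝓝 0) ∧
    Tendsto (fun k => eLpNorm (fun x => gradient (v k) x - G x) 2 (volume.restrict Ω))
      atTop (𝓝 0)

/-- `w` is an eigenfunction of the Dirichlet Laplacian: `w ≠ 0`, `w ∈ H¹₀(Ω)` and
`-Δ w = lam w` in `Ω` in the weak sense. -/
def IsDirichletEigenfunction {d : ℕ} (Ω : Set (EuclideanSpace ℝ (Fin d)))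
    (lam : ℝ) (w : L2 Ω) : Prop :=
  w ≠ 0 ∧
  ∃ G : Lp (EuclideanSpace ℝ (Fin d)) 2 (volume.restrict Ω), HasH10Gradient Ω w G ∧
    ∀ v : EuclideanSpace ℝ (Fin d) → ℝ, IsTestFunction Ω v →
      ∫ x in Ω, inner ℝ (G x) (gradient v x) = lam * ∫ x in Ω, w x * v x

/-- `lam 0 ≤ lam 1 ≤ …` are the Dirichlet eigenvalues of `-Δ` on `Ω` with multiplicity, and the
orthonormal basis `φ` of `L²(Ω)` consists of corresponding eigenfunctions. Indices start at `0`,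
so `lam 0` is the first eigenvalue. -/
def IsDirichletEigensystem {d : ℕ} (Ω : Set (EuclideanSpace ℝ (Fin d)))
    (lam : ℕ → ℝ) (φ : HilbertBasis ℕ ℝ (L2 Ω)) : Prop :=
  Monotone lam ∧ ∀ n, IsDirichletEigenfunction Ω (lam n) (φ n)

/-- `u ∈ C([0,τ]; L²(Ω))` is a weak solution of
`u_tt - 2 Δ u_t + Δ² u = ψ(t) f(x)` in `Ω × (0,τ)`, `u = Δu = 0` on `∂Ω × (0,τ)`,
`u(0) = u_t(0) = 0`. The equation is tested with the eigenfunctions `w` of the Dirichlet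
Laplacian; as `-Δ w = lam w`, moving the Laplacians onto `w` gives
`⟨u,w⟩'' + 2 lam ⟨u,w⟩' + lam² ⟨u,w⟩ = ψ ⟨f,w⟩`. Here `y₁` is the derivative of `⟨u,w⟩`. -/
def IsBiparabolicSolution {d : ℕ} (Ω : Set (EuclideanSpace ℝ (Fin d)))
    (τ : ℝ) (ψ : ℝ → ℝ) (f : L2 Ω) (u : ℝ → L2 Ω) : Prop :=
  ContinuousOn u (Icc 0 τ) ∧
  ∀ (lam : ℝ) (w : L2 Ω), IsDirichletEigenfunction Ω lam w →
    ∃ y₁ : ℝ → ℝ,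
      (∀ t ∈ Icc 0 τ, HasDerivWithinAt (fun s => inner ℝ (u s) w) (y₁ t) (Icc 0 τ) t) ∧
      (∀ t ∈ Icc 0 τ, HasDerivWithinAt y₁
        (ψ t * inner ℝ f w - 2 * lam * y₁ t - lam ^ 2 * inner ℝ (u t) w) (Icc 0 τ) t) ∧
      inner ℝ (u 0) w = 0 ∧ y₁ 0 = 0

/-- `μ(t) = ∫₀ᵗ e^{-lam (t-s)} (t-s) ψ(s) ds`. -/
def mu (ψ : ℝ → ℝ) (lam t : ℝ) : ℝ :=
  ∫ s in (0 : ℝ)..t, Real.exp (-lam * (t - s)) * (t - s) * ψ s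

/-- The space `ℍ_p`. -/
def SpaceH {d : ℕ} {Ω : Set (EuclideanSpace ℝ (Fin d))} (lam : ℕ → ℝ)
    (φ : HilbertBasis ℕ ℝ (L2 Ω)) (p : ℝ) : Set (L2 Ω) :=
  {g | Summable fun n => lam n ^ (2 * p) * inner ℝ g (φ n) ^ 2}

/-- The source set `S_{ϱ,p}`, the ball of radius `ϱ` in `ℍ_p`. -/
def SourceSet {d : ℕ} {Ω : Set (EuclideanSpace ℝ (Fin d))} (lam : ℕ → ℝ)
    (φ : HilbertBasis ℕ ℝ (L2 Ω)) (ϱ p : ℝ) : Set (L2 Ω) :=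
  {g | g ∈ SpaceH lam φ p ∧ ∑' n, lam n ^ (2 * p) * inner ℝ g (φ n) ^ 2 ≤ ϱ ^ 2}

/-- `v` is the mild solution of
`v_tt - 2 Δ v_t + Δ² v = (I + α (-Δ)^b) ψ(t) f(x)`, `v = Δv = 0` on the boundary,
`v(0) = v_t(0) = 0`, for a source `f ∈ ℍ_{b-2}`. -/
def IsMildSolution {d : ℕ} {Ω : Set (EuclideanSpace ℝ (Fin d))} (lam : ℕ → ℝ)
    (φ : HilbertBasis ℕ ℝ (L2 Ω)) (τ : ℝ) (ψ : ℝ → ℝ) (b α : ℝ)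
    (f : L2 Ω) (v : ℝ → L2 Ω) : Prop :=
  f ∈ SpaceH lam φ (b - 2) ∧ ContinuousOn v (Icc 0 τ) ∧
  ∀ t ∈ Icc 0 τ,
    HasSum (fun n => ((1 + α * lam n ^ b) * mu ψ (lam n) t * inner ℝ f (φ n)) • φ n) (v t)

/-- `f` solves the quasi-reversibility problem with final value `g`, that is, `f = 𝕋_α⁻¹ g`: the
mild solution with source `f` takes the value `g = 𝕋_α f` at the final time `τ`. -/
def IsQRSource {d : ℕ} {Ω : Set (EuclideanSpace ℝ (Fin d))} (lam : ℕ → ℝ)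
    (φ : HilbertBasis ℕ ℝ (L2 Ω)) (τ : ℝ) (ψ : ℝ → ℝ) (b α : ℝ) (g f : L2 Ω) : Prop :=
  ∃ v : ℝ → L2 Ω, IsMildSolution lam φ τ ψ b α f v ∧ v τ = g

/-- The assumption on the time-dependent part `ψ` of the source. -/
def PsiAssumption (τ : ℝ) (ψ : ℝ → ℝ) : Prop :=
  ∃ τ₀ κ₁ : ℝ, 0 ≤ τ₀ ∧ τ₀ < τ ∧ 0 < κ₁ ∧ (∀ t ∈ Icc τ₀ τ, κ₁ ≤ |ψ t|) ∧
    (((∀ t ∈ Icc 0 τ, 0 ≤ ψ t) ∨ (∀ t ∈ Icc 0 τ, ψ t ≤ 0)) ∨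
      (DifferentiableOn ℝ ψ (Icc 0 τ) ∧
        (∃ κ₂ : ℝ, 0 < κ₂ ∧ ∀ t ∈ Icc 0 τ, |derivWithin ψ (Icc 0 τ) t| ≤ κ₂) ∧
        ∀ t ∈ Icc 0 τ, ψ t * ψ τ ≤ 0 → |ψ t| ≤ (τ - τ₀) ^ 2 * κ₁ / (4 * τ * τ₀)))

/-- `|μ_n(τ)| ≥ C / λ_n²` for all `n`. -/
def IsLowerConstant (lam : ℕ → ℝ) (τ : ℝ) (ψ : ℝ → ℝ) (C : ℝ) : Prop :=
  0 < C ∧ ∀ n, C / lam n ^ 2 ≤ |mu ψ (lam n) τ|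

end BiParabolic

end

/-! In the basis `φ` everything is diagonal. Duhamel gives `h_n = μ_n f_n`, while `𝕋_α` multiplies
the n-th coefficient by `(1 + α λ_n^b) μ_n`. Hence the coefficients of `f - f_α` are `α λ_n^b / (1 +
α λ_n^b) * f_n`, and those of `f_α - f_α^δ` are the data error divided by `(1 + α λ_n^b) μ_n`. By
Parseval, both estimates reduce to scalar bounds uniform in `λ_n`: `sq_div_one_add_le` for (i),
`filter_le_of_lt` and `filter_le_of_le` for (ii).

The analytic core is `|μ_n| ≥ C / λ_n²` (`PsiAssumption.exists_lower`). The kernel concentrates near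
`s = τ`, where `ψ` has a fixed sign and size at least `κ₁`; a wrong sign before `τ₀` is damped by
`exp (-λ(τ - τ₀))`, and the bound imposed on `ψ` there keeps the loss below the gain. Uniformity in
`n` needs `λ_1 > 0`, which comes from the Poincaré inequality. -/

namespace BiParabolic

/-! ### Poincaré inequality and positivity of the Dirichlet eigenvalues. -/

section Eigenvalues

variable {d : ℕ} {Ω : Set (EuclideanSpace ℝ (Fin d))}

lemma continuous_gradient_of_contDiff {v : EuclideanSpace ℝ (Fin d) → ℝ} (hv : ContDiff ℝ ∞ v) :
    Continuous (gradient v) :=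
  (InnerProductSpace.toDual ℝ _).symm.continuous.comp (hv.continuous_fderiv (by simp))

lemma hasCompactSupport_gradient {v : EuclideanSpace ℝ (Fin d) → ℝ} (hv : HasCompactSupport v) :
    HasCompactSupport (gradient v) :=
  (hv.fderiv ℝ).comp_left (g := (InnerProductSpace.toDual ℝ _).symm) (map_zero _)

lemma IsTestFunction.memLp {v : EuclideanSpace ℝ (Fin d) → ℝ} (hv : IsTestFunction Ω v) :
    MemLp v 2 (volume.restrict Ω) :=
  hv.1.continuous.memLp_of_hasCompactSupport hv.2.1

lemma IsTestFunction.memLp_gradient {v : EuclideanSpace ℝ (Fin d) → ℝ}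
    (hv : IsTestFunction Ω v) : MemLp (gradient v) 2 (volume.restrict Ω) :=
  (continuous_gradient_of_contDiff hv.1).memLp_of_hasCompactSupport
    (hasCompactSupport_gradient hv.2.1)

/-- The Poincaré inequality for test functions on a bounded set. -/
lemma IsTestFunction.integral_sq_le (hd : 1 ≤ d) {R : ℝ} (hR : ∀ x ∈ Ω, ‖x‖ ≤ R)
    {v : EuclideanSpace ℝ (Fin d) → ℝ} (hv : IsTestFunction Ω v) :
    ∫ x in Ω, v x ^ 2 ≤ 4 * R ^ 2 * ∫ x in Ω, ‖gradient v x‖ ^ 2 := by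
  have hvc := hv.1.continuous
  have hgc := continuous_gradient_of_contDiff hv.1
  have hgs := hasCompactSupport_gradient hv.2.1
  have hout : ∀ x ∉ Ω, v x = 0 := fun x hx =>
    image_eq_zero_of_notMem_tsupport fun h => hx (hv.2.2 h)
  have hgout : ∀ x ∉ Ω, gradient v x = 0 := fun x hx => by
    have : fderiv ℝ v x = 0 := image_eq_zero_of_notMem_tsupport
      fun h => hx (hv.2.2 (tsupport_fderiv_subset ℝ h))
    simp [gradient, this]
  rw [setIntegral_eq_integral_of_forall_compl_eq_zero (fun x hx => by simp [hout x hx]),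
    setIntegral_eq_integral_of_forall_compl_eq_zero (fun x hx => by simp [hgout x hx])]
  let i : Fin d := ⟨0, hd⟩
  let e : EuclideanSpace ℝ (Fin d) := EuclideanSpace.single i 1
  let π : EuclideanSpace ℝ (Fin d) →L[ℝ] ℝ := EuclideanSpace.proj i
  have he : ‖e‖ = 1 := by simp [e]
  have hπe : π e = 1 := by simp [π, e]
  have hπ : ∀ x, |π x| ≤ ‖x‖ := fun x => by
    simpa [π] using PiLp.norm_apply_le x i
  have hvd : Differentiable ℝ v := hv.1.differentiable (by simp)
  have hfd : ∀ x, fderiv ℝ (fun y => v y ^ 2) x e = 2 * v x * inner ℝ (gradient v x) e := by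
    intro x
    rw [inner_gradient_left, ((hvd x).hasFDerivAt.pow 2).fderiv]
    simp
  have hi1 : Integrable (fun x => v x ^ 2) :=
    (by fun_prop : Continuous fun x => v x ^ 2).integrable_of_hasCompactSupport
      (hv.2.1.comp_left (g := fun y : ℝ => y ^ 2) (by simp))
  have hi2 : Integrable (fun x => ‖gradient v x‖ ^ 2) :=
    (by fun_prop : Continuous fun x => ‖gradient v x‖ ^ 2).integrable_of_hasCompactSupport
      (hgs.comp_left (g := fun y => ‖y‖ ^ 2) (by simp))
  have hi3 : Integrable (fun x => 2 * v x * inner ℝ (gradient v x) e * π x) := by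
    refine Continuous.integrable_of_hasCompactSupport (by fun_prop) ?_
    exact ((hv.2.1.mul_left (f := fun _ => (2 : ℝ))).mul_right).mul_right
  have hi4 : Integrable (fun x => v x ^ 2 * π x) :=
    Continuous.integrable_of_hasCompactSupport (by fun_prop)
      ((hv.2.1.comp_left (g := fun y : ℝ => y ^ 2) (by simp)).mul_right)
  -- As `∂_e π = 1`, integrating by parts in one coordinate direction turns `∫ v²` into `-∫ 2 v (∂_e
  -- v) π`, and `|π| ≤ R` on `Ω`.
  have key := integral_mul_fderiv_eq_neg_fderiv_mul_of_integrable (μ := volume)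
    (f := fun x => v x ^ 2) (g := π) (v := e) (by simpa [hfd] using hi3)
    (by simpa [hπe] using hi1) hi4 (fun x _ => (hvd x).pow 2) (fun x _ => π.differentiableAt)
  simp only [ContinuousLinearMap.fderiv, hπe, mul_one, hfd] at key
  have hle : ∫ x, v x ^ 2 ≤ ∫ x, (1 / 2 * v x ^ 2 + 2 * R ^ 2 * ‖gradient v x‖ ^ 2) := by
    rw [key, ← integral_neg]
    refine integral_mono hi3.neg ((hi1.const_mul _).add (hi2.const_mul _)) fun x => ?_
    by_cases hx : x ∈ Ω
    · have h1 : |inner ℝ (gradient v x) e| ≤ ‖gradient v x‖ := by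
        simpa [he] using abs_real_inner_le_norm (gradient v x) e
      have h2 : |π x| ≤ R := (hπ x).trans (hR x hx)
      have h3 : -(2 * v x * inner ℝ (gradient v x) e * π x)
          ≤ 2 * |v x| * (‖gradient v x‖ * R) := by
        refine (neg_le_abs _).trans ?_
        rw [abs_mul, abs_mul, abs_mul, abs_two, mul_assoc (2 * |v x|)]
        gcongr
      -- Young's inequality, weighted so that half of `∫ v²` can be absorbed on the left.
      have h4 := sq_nonneg (|v x| - 2 * (‖gradient v x‖ * R))
      have h5 := sq_abs (v x)
      simp only
      nlinarith
    · simp [hout x hx, hgout x hx]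
  rw [integral_add (hi1.const_mul _) (hi2.const_mul _), integral_const_mul,
    integral_const_mul] at hle
  linarith

/-- Dirichlet eigenvalues on a bounded set are positive. -/
lemma IsDirichletEigenfunction.pos (hd : 1 ≤ d) (hΩb : Bornology.IsBounded Ω) {lam : ℝ}
    {w : L2 Ω} (h : IsDirichletEigenfunction Ω lam w) : 0 < lam := by
  obtain ⟨hw0, G, ⟨v, hv, hvw, hvG⟩, hweak⟩ := h
  obtain ⟨R, hR⟩ := hΩb.exists_norm_le
  have hV : Tendsto (fun k => (hv k).memLp.toLp (v k)) atTop (𝓝 w) := by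
    rw [← Lp.toLp_coeFn w (Lp.memLp w)]
    exact (Lp.tendsto_Lp_iff_tendsto_eLpNorm'' v (fun k => (hv k).memLp) w (Lp.memLp w)).2 hvw
  have hD : Tendsto (fun k => (hv k).memLp_gradient.toLp (gradient (v k))) atTop (𝓝 G) := by
    rw [← Lp.toLp_coeFn G (Lp.memLp G)]
    exact (Lp.tendsto_Lp_iff_tendsto_eLpNorm'' (fun k => gradient (v k))
      (fun k => (hv k).memLp_gradient) G (Lp.memLp G)).2 hvG
  have hweak' : ∀ k, inner ℝ G ((hv k).memLp_gradient.toLp (gradient (v k)))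
      = lam * inner ℝ w ((hv k).memLp.toLp (v k)) := by
    intro k
    have h1 : inner ℝ G ((hv k).memLp_gradient.toLp (gradient (v k)))
        = ∫ x in Ω, inner ℝ (G x) (gradient (v k) x) := by
      rw [L2.inner_def]
      refine integral_congr_ae ?_
      filter_upwards [(hv k).memLp_gradient.coeFn_toLp] with x hx
      rw [hx]
    have h2 : inner ℝ w ((hv k).memLp.toLp (v k)) = ∫ x in Ω, w x * v k x := by
      rw [L2.inner_def]
      refine integral_congr_ae ?_
      filter_upwards [(hv k).memLp.coeFn_toLp] with x hx
      rw [hx]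
      simp [mul_comm]
    rw [h1, h2, hweak _ (hv k)]
  -- The weak equation is tested with the approximants of `w`, then passed to the limit.
  have heq : ‖G‖ ^ 2 = lam * ‖w‖ ^ 2 := by
    rw [← real_inner_self_eq_norm_sq, ← real_inner_self_eq_norm_sq]
    refine tendsto_nhds_unique (tendsto_const_nhds.inner hD) ?_
    simp only [hweak']
    exact (tendsto_const_nhds.inner hV).const_mul lam
  have hP : ∀ k, ‖(hv k).memLp.toLp (v k)‖ ^ 2
      ≤ 4 * R ^ 2 * ‖(hv k).memLp_gradient.toLp (gradient (v k))‖ ^ 2 := by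
    intro k
    have h1 : ‖(hv k).memLp.toLp (v k)‖ ^ 2 = ∫ x in Ω, v k x ^ 2 := by
      rw [← real_inner_self_eq_norm_sq, L2.inner_def]
      refine integral_congr_ae ?_
      filter_upwards [(hv k).memLp.coeFn_toLp] with x hx
      rw [hx]
      simp
    have h2 : ‖(hv k).memLp_gradient.toLp (gradient (v k))‖ ^ 2
        = ∫ x in Ω, ‖gradient (v k) x‖ ^ 2 := by
      rw [← real_inner_self_eq_norm_sq, L2.inner_def]
      refine integral_congr_ae ?_
      filter_upwards [(hv k).memLp_gradient.coeFn_toLp] with x hx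
      rw [hx, real_inner_self_eq_norm_sq]
    rw [h1, h2]
    exact (hv k).integral_sq_le hd hR
  have hle : ‖w‖ ^ 2 ≤ 4 * R ^ 2 * ‖G‖ ^ 2 :=
    le_of_tendsto_of_tendsto' (hV.norm.pow 2) ((hD.norm.pow 2).const_mul _) hP
  have hwpos : 0 < ‖w‖ ^ 2 := by positivity
  by_contra hneg
  have : ‖G‖ ^ 2 ≤ 0 := heq ▸ mul_nonpos_of_nonpos_of_nonneg (not_lt.1 hneg) hwpos.le
  nlinarith [mul_nonneg (by positivity : 0 ≤ 4 * R ^ 2) (neg_nonneg.2 this)]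

end Eigenvalues

end BiParabolic

namespace BiParabolic

/-! ### The multipliers `μ`: bounds, continuity, Duhamel's formula. -/

section Kernel

lemma integral_kernel {lam : ℝ} (hl : 0 < lam) (a t : ℝ) :
    ∫ s in a..t, Real.exp (-lam * (t - s)) * (t - s)
      = (1 - Real.exp (-(lam * (t - a))) * (1 + lam * (t - a))) / lam ^ 2 := by
  have hF : ∀ s ∈ uIcc a t, HasDerivAt
      (fun s => Real.exp (-lam * (t - s)) * (1 + lam * (t - s)) / lam ^ 2)
      (Real.exp (-lam * (t - s)) * (t - s)) s := by
    intro s _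
    have h1 : HasDerivAt (fun s => t - s) (-1) s := by
      simpa using (hasDerivAt_id s).const_sub t
    have h2 := (((h1.const_mul (-lam)).exp).mul ((h1.const_mul lam).const_add 1)).div_const
      (lam ^ 2)
    refine h2.congr_deriv ?_
    field_simp
    ring
  rw [intervalIntegral.integral_eq_sub_of_hasDerivAt hF
    ((by fun_prop : Continuous fun s => Real.exp (-lam * (t - s)) * (t - s)).intervalIntegrable
      _ _)]
  simp only [sub_self, mul_zero, Real.exp_zero, neg_mul]
  ring

/-- The kernel is nonnegative with integral at most `1 / lam²`. Uniformity in `t` later yields a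
summable majorant for the mild solution. -/
lemma abs_mu_le {τ lam K t : ℝ} {ψ : ℝ → ℝ} (hl : 0 < lam) (hK : ∀ s ∈ Icc 0 τ, |ψ s| ≤ K)
    (ht : t ∈ Icc 0 τ) : |mu ψ lam t| ≤ K / lam ^ 2 := by
  have hK0 : 0 ≤ K := (abs_nonneg _).trans (hK t ht)
  have h1 : |mu ψ lam t| ≤ ∫ s in (0 : ℝ)..t, Real.exp (-lam * (t - s)) * (t - s) * K := by
    rw [mu, ← Real.norm_eq_abs]
    refine intervalIntegral.norm_integral_le_of_norm_le ht.1 (ae_of_all _ fun s hs => ?_)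
      ((by fun_prop : Continuous fun s => Real.exp (-lam * (t - s)) * (t - s) * K
        ).intervalIntegrable _ _)
    have h0 : 0 ≤ t - s := sub_nonneg.2 hs.2
    rw [Real.norm_eq_abs, abs_mul, abs_of_nonneg (by positivity)]
    gcongr
    exact hK s ⟨hs.1.le, hs.2.trans ht.2⟩
  rw [intervalIntegral.integral_mul_const, integral_kernel hl] at h1
  refine h1.trans ?_
  rw [div_mul_eq_mul_div]
  have h2 : 0 ≤ Real.exp (-(lam * (t - 0))) * (1 + lam * (t - 0)) := by
    have := ht.1
    rw [sub_zero]
    positivity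
  gcongr
  nlinarith

lemma continuousOn_mu {τ : ℝ} (hτ : 0 < τ) {ψ : ℝ → ℝ} (hψ : ContinuousOn ψ (Icc 0 τ))
    (lam : ℝ) : ContinuousOn (mu ψ lam) (Icc 0 τ) := by
  let χ : ℝ → ℝ := IccExtend hτ.le ((Icc 0 τ).domRestrict ψ)
  have hχ : Continuous χ := (continuousOn_iff_continuous_domRestrict.1 hψ).Icc_extend'
  have hcont : Continuous fun t => ∫ s in (0 : ℝ)..t,
      Real.exp (-lam * (t - s)) * (t - s) * χ s :=
    intervalIntegral.continuous_parametric_intervalIntegral_of_continuous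
      (f := fun t s => Real.exp (-lam * (t - s)) * (t - s) * χ s)
      (by unfold Function.uncurry; fun_prop) continuous_id
  refine hcont.continuousOn.congr fun t ht => ?_
  refine intervalIntegral.integral_congr fun s hs => ?_
  rw [uIcc_of_le ht.1] at hs
  have : χ s = ψ s := IccExtend_of_mem hτ.le _ ⟨hs.1, hs.2.trans ht.2⟩
  simp only [this]

/-- Up to a global sign, `ψ` is bounded below by `κ` near `τ` and only slightly negative
elsewhere. -/
lemma PsiAssumption.exists_sign {τ : ℝ} {ψ : ℝ → ℝ} (hψ : ContinuousOn ψ (Icc 0 τ))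
    (hA : PsiAssumption τ ψ) :
    ∃ σ τ₀ κ M : ℝ, |σ| = 1 ∧ 0 ≤ τ₀ ∧ τ₀ < τ ∧ 0 < κ ∧ 0 ≤ M ∧
      4 * (M * (τ * τ₀)) ≤ (τ - τ₀) ^ 2 * κ ∧ (∀ t ∈ Icc τ₀ τ, κ ≤ σ * ψ t) ∧
      ∀ t ∈ Icc 0 τ₀, -M ≤ σ * ψ t := by
  obtain ⟨τ₀, κ, h0, h1, hκ, hlow, hcase⟩ := hA
  have hτ : 0 < τ := h0.trans_lt h1
  have hne : ∀ t ∈ Icc τ₀ τ, ψ t ≠ 0 := fun t ht h => by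
    have := hlow t ht
    simp [h] at this
    linarith
  have hτne : ψ τ ≠ 0 := hne τ ⟨h1.le, le_rfl⟩
  have hM : ∃ M : ℝ, 0 ≤ M ∧ 4 * (M * (τ * τ₀)) ≤ (τ - τ₀) ^ 2 * κ ∧
      ∀ t ∈ Icc 0 τ, ψ t * ψ τ ≤ 0 → |ψ t| ≤ M := by
    rcases hcase with hs | ⟨_, _, hs⟩
    · refine ⟨0, le_rfl, by simp; positivity, fun t ht hle => ?_⟩
      have hτmem : τ ∈ Icc 0 τ := ⟨hτ.le, le_rfl⟩
      have : ψ t * ψ τ = 0 := le_antisymm hle <| hs.elim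
        (fun hs => mul_nonneg (hs t ht) (hs τ hτmem))
        (fun hs => mul_nonneg_of_nonpos_of_nonpos (hs t ht) (hs τ hτmem))
      simp [(mul_eq_zero.1 this).resolve_right hτne]
    · refine ⟨_, ?_, ?_, hs⟩
      · positivity
      -- For `τ₀ = 0` the quotient is a division by zero with value `0`, so `M = 0`; otherwise the
      -- inequality is an equality.
      · rcases h0.eq_or_lt with rfl | h0
        · simp
          positivity
        · apply le_of_eq
          field_simp
  obtain ⟨M, hM0, hMle, hM⟩ := hM
  -- A sign change on `[τ₀, τ]` would force a zero of `ψ` there.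
  have hpos : ∀ t ∈ Icc τ₀ τ, 0 < ψ t * ψ τ := by
    intro t ht
    by_contra hcon
    have hc : ContinuousOn (fun s => ψ s * ψ τ) (Icc t τ) :=
      (hψ.mono (Icc_subset_Icc_left (h0.trans ht.1))).mul continuousOn_const
    obtain ⟨s, hs, hs0⟩ := intermediate_value_Icc ht.2 hc
      ⟨not_lt.1 hcon, (mul_self_nonneg (ψ τ))⟩
    exact mul_ne_zero (hne s ⟨ht.1.trans hs.1, hs.2⟩) hτne hs0
  have hsub : ∀ t ∈ Icc 0 τ₀, t ∈ Icc 0 τ := fun t ht => ⟨ht.1, ht.2.trans h1.le⟩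
  rcases hτne.lt_or_gt with hneg | hpos'
  · refine ⟨-1, τ₀, κ, M, by simp, h0, h1, hκ, hM0, hMle, fun t ht => ?_, fun t ht => ?_⟩
    · have h2 : ψ t < 0 := by
        by_contra hc
        nlinarith [hpos t ht, not_lt.1 hc]
      have := hlow t ht
      rw [abs_of_neg h2] at this
      linarith
    · rcases le_or_gt (ψ t) 0 with h2 | h2
      · linarith
      · have := (abs_le.1 (hM t (hsub t ht) (mul_nonpos_of_nonneg_of_nonpos h2.le hneg.le))).2
        linarith
  · refine ⟨1, τ₀, κ, M, by simp, h0, h1, hκ, hM0, hMle, fun t ht => ?_, fun t ht => ?_⟩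
    · have h2 : 0 < ψ t := pos_of_mul_pos_left (hpos t ht) hpos'.le
      have := hlow t ht
      rw [abs_of_pos h2] at this
      linarith
    · rcases le_or_gt 0 (ψ t) with h2 | h2
      · linarith
      · have := (abs_le.1 (hM t (hsub t ht) (mul_nonpos_of_nonpos_of_nonneg h2.le hpos'.le))).1
        linarith

/-- Since `exp x ≥ 1 + x + x²/2`, the right side is at least `(x²/4) / (1 + x + x²/2)`, which
increases with `x`. -/
lemma exp_quadratic_gap {x₀ x : ℝ} (h0 : 0 < x₀) (hx : x₀ ≤ x) :
    x₀ ^ 2 / 4 / (1 + x₀ + x₀ ^ 2 / 2) ≤ 1 - Real.exp (-x) * (1 + x + x ^ 2 / 4) := by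
  have hx0 : 0 < x := h0.trans_le hx
  have h1 : x₀ ^ 2 / 4 / (1 + x₀ + x₀ ^ 2 / 2) ≤ x ^ 2 / 4 / (1 + x + x ^ 2 / 2) := by
    rw [div_le_div_iff₀ (by positivity) (by positivity)]
    nlinarith [mul_nonneg (sub_nonneg.2 hx) (mul_pos h0 hx0).le, pow_le_pow_left₀ h0.le hx 2]
  have h2 : Real.exp (-x) ≤ 1 / (1 + x + x ^ 2 / 2) := by
    rw [Real.exp_neg, ← one_div]
    exact one_div_le_one_div_of_le (by positivity) (Real.quadratic_le_exp_of_nonneg hx0.le)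
  have h3 : Real.exp (-x) * (1 + x + x ^ 2 / 4)
      ≤ 1 / (1 + x + x ^ 2 / 2) * (1 + x + x ^ 2 / 4) := by gcongr
  have h4 : x ^ 2 / 4 / (1 + x + x ^ 2 / 2)
      = 1 - 1 / (1 + x + x ^ 2 / 2) * (1 + x + x ^ 2 / 4) := by
    field_simp
    ring
  linarith

/-- With `x = lam (τ - τ₀)`, the part over `[τ₀, τ]` gives at least `κ (1 - e⁻ˣ(1 + x)) / lam²` and
the part over `[0, τ₀]` loses at most `M τ τ₀ e⁻ˣ`. The gap lemma bounds the difference below. -/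
lemma PsiAssumption.exists_lower {τ : ℝ} {ψ : ℝ → ℝ} (hψ : ContinuousOn ψ (Icc 0 τ))
    (hA : PsiAssumption τ ψ) {lam₀ : ℝ} (hl₀ : 0 < lam₀) :
    ∃ C : ℝ, 0 < C ∧ ∀ lam, lam₀ ≤ lam → C / lam ^ 2 ≤ |mu ψ lam τ| := by
  obtain ⟨σ, τ₀, κ, M, hσ, h0, h1, hκ, hM0, hM, hhigh, hlow⟩ := hA.exists_sign hψ
  have hT : 0 < τ - τ₀ := sub_pos.2 h1
  have hx₀ : 0 < lam₀ * (τ - τ₀) := mul_pos hl₀ hT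
  set x₀ := lam₀ * (τ - τ₀)
  refine ⟨κ * (x₀ ^ 2 / 4 / (1 + x₀ + x₀ ^ 2 / 2)), by positivity, fun lam hlam => ?_⟩
  have hl : 0 < lam := hl₀.trans_le hlam
  let k : ℝ → ℝ := fun s => Real.exp (-lam * (τ - s)) * (τ - s)
  have hk : Continuous k := by fun_prop
  have hint : ∀ a b, 0 ≤ a → a ≤ b → b ≤ τ →
      IntervalIntegrable (fun s => k s * (σ * ψ s)) volume a b := fun a b ha hab hb =>
    ContinuousOn.intervalIntegrable_of_Icc hab
      (hk.continuousOn.mul (continuousOn_const.mul (hψ.mono (Icc_subset_Icc ha hb))))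
  have hmu : σ * mu ψ lam τ = ∫ s in (0 : ℝ)..τ, k s * (σ * ψ s) := by
    rw [mu, ← intervalIntegral.integral_const_mul]
    refine intervalIntegral.integral_congr fun s _ => ?_
    simp only [k]
    ring
  have hsplit := intervalIntegral.integral_add_adjacent_intervals
    (hint 0 τ₀ le_rfl h0 h1.le) (hint τ₀ τ h0 h1.le le_rfl)
  have hA1 : ∫ s in (0 : ℝ)..τ₀, -(M * (Real.exp (-(lam * (τ - τ₀))) * τ))
      ≤ ∫ s in (0 : ℝ)..τ₀, k s * (σ * ψ s) := by
    refine intervalIntegral.integral_mono_on h0 (by simp) (hint 0 τ₀ le_rfl h0 h1.le)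
      fun s hs => ?_
    have h2 : 0 ≤ τ - s := by linarith [hs.2]
    have h3 : k s ≤ Real.exp (-(lam * (τ - τ₀))) * τ := by
      refine mul_le_mul (Real.exp_le_exp.2 ?_) (by linarith [hs.1]) h2 (Real.exp_pos _).le
      nlinarith [hs.2]
    have h4 : 0 ≤ k s := mul_nonneg (Real.exp_pos _).le h2
    nlinarith [hlow s hs, mul_le_mul_of_nonneg_left (hlow s hs) h4,
      mul_le_mul_of_nonneg_left h3 hM0]
  have hA2 : ∫ s in τ₀..τ, k s * κ ≤ ∫ s in τ₀..τ, k s * (σ * ψ s) := by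
    refine intervalIntegral.integral_mono_on h1.le
      ((hk.mul continuous_const).intervalIntegrable _ _) (hint τ₀ τ h0 h1.le le_rfl)
      fun s hs => ?_
    exact mul_le_mul_of_nonneg_left (hhigh s hs)
      (mul_nonneg (Real.exp_pos _).le (sub_nonneg.2 hs.2))
  rw [intervalIntegral.integral_mul_const, integral_kernel hl] at hA2
  rw [intervalIntegral.integral_const, smul_eq_mul, sub_zero] at hA1
  have hgap := exp_quadratic_gap hx₀
    (mul_le_mul_of_nonneg_right hlam hT.le : lam₀ * (τ - τ₀) ≤ lam * (τ - τ₀))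
  set E := Real.exp (-(lam * (τ - τ₀)))
  have hE : 0 < E := Real.exp_pos _
  -- The factor 4 in the hypothesis on `ψ` makes the loss at most `κ e⁻ˣ (x²/4) / lam²`, half of the
  -- quadratic term of the exponential.
  have hM' : M * (τ * τ₀) * E ≤ κ * (E * ((lam * (τ - τ₀)) ^ 2 / 4)) / lam ^ 2 := by
    have : κ * (E * ((lam * (τ - τ₀)) ^ 2 / 4)) / lam ^ 2 = (τ - τ₀) ^ 2 * κ / 4 * E := by
      field_simp
    rw [this]
    gcongr
    linarith
  calc κ * (x₀ ^ 2 / 4 / (1 + x₀ + x₀ ^ 2 / 2)) / lam ^ 2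
      ≤ κ * (1 - E * (1 + lam * (τ - τ₀) + (lam * (τ - τ₀)) ^ 2 / 4)) / lam ^ 2 := by gcongr
    _ = (1 - E * (1 + lam * (τ - τ₀))) / lam ^ 2 * κ
        - κ * (E * ((lam * (τ - τ₀)) ^ 2 / 4)) / lam ^ 2 := by ring
    _ ≤ (1 - E * (1 + lam * (τ - τ₀))) / lam ^ 2 * κ - M * (τ * τ₀) * E := by linarith
    _ ≤ σ * mu ψ lam τ := by rw [hmu]; linarith
    _ ≤ |σ * mu ψ lam τ| := le_abs_self _
    _ = |mu ψ lam τ| := by rw [abs_mul, hσ, one_mul]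

/-- Duhamel's formula at the final time. -/
lemma eq_mul_mu_of_hasDerivWithinAt {τ lam c : ℝ} (hτ : 0 < τ) {ψ y y₁ : ℝ → ℝ}
    (hψ : ContinuousOn ψ (Icc 0 τ))
    (hy : ∀ t ∈ Icc 0 τ, HasDerivWithinAt y (y₁ t) (Icc 0 τ) t)
    (hy₁ : ∀ t ∈ Icc 0 τ, HasDerivWithinAt y₁
      (ψ t * c - 2 * lam * y₁ t - lam ^ 2 * y t) (Icc 0 τ) t)
    (h0 : y 0 = 0) (h1 : y₁ 0 = 0) : y τ = mu ψ lam τ * c := by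
  -- The equation is `(d/ds + lam)² y = ψ c`. `W` is chosen so that `W'` is the integrand of `mu`
  -- times `c`, with `W 0 = 0` and `W τ = y τ`.
  let W : ℝ → ℝ := fun s => Real.exp (-lam * (τ - s)) * ((τ - s) * (y₁ s + lam * y s) + y s)
  have hW : ∀ t ∈ Icc 0 τ, HasDerivWithinAt W
      (Real.exp (-lam * (τ - t)) * (τ - t) * ψ t * c) (Icc 0 τ) t := by
    intro t ht
    have h2 : HasDerivWithinAt (fun s => τ - s) (-1) (Icc 0 τ) t := by
      simpa using (hasDerivWithinAt_id t _).const_sub τ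
    have h3 := (h2.const_mul (-lam)).exp.mul
      ((h2.mul ((hy₁ t ht).add ((hy t ht).const_mul lam))).add (hy t ht))
    refine h3.congr_deriv ?_
    simp only [Pi.add_apply, Pi.mul_apply]
    ring
  have hFTC := intervalIntegral.integral_eq_sub_of_hasDerivAt_of_le hτ.le
    (fun t ht => (hW t ht).continuousWithinAt)
    (fun t ht => (hW t (Ioo_subset_Icc_self ht)).hasDerivAt (Icc_mem_nhds ht.1 ht.2))
    (ContinuousOn.intervalIntegrable_of_Icc hτ.le (by fun_prop))
  rw [intervalIntegral.integral_mul_const] at hFTC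
  rw [mu, hFTC]
  simp [W, h0, h1]

end Kernel

end BiParabolic

namespace BiParabolic

/-! ### Expansions in a Hilbert basis. -/

section Hilbert

variable {E : Type*} [NormedAddCommGroup E] [InnerProductSpace ℝ E] (φ : HilbertBasis ℕ ℝ E)

lemma hasSum_inner_sq (x : E) : HasSum (fun n => inner ℝ x (φ n) ^ 2) (‖x‖ ^ 2) := by
  rw [← real_inner_self_eq_norm_sq]
  refine (φ.hasSum_inner_mul_inner x x).congr_fun ?_
  intro n
  rw [real_inner_comm x (φ n), sq]

lemma eq_of_inner_basis {x y : E} (h : ∀ n, inner ℝ x (φ n) = inner ℝ y (φ n)) : x = y := by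
  have h1 := hasSum_inner_sq φ (x - y)
  simp only [inner_sub_left, h, sub_self] at h1
  have h2 : ‖x - y‖ ^ 2 = 0 := h1.unique (by simp)
  exact sub_eq_zero.1 (norm_eq_zero.1 (pow_eq_zero_iff two_ne_zero |>.1 h2))

lemma inner_of_hasSum {c : ℕ → ℝ} {x : E} (h : HasSum (fun n => c n • φ n) x) (n : ℕ) :
    inner ℝ x (φ n) = c n := by
  have h1 : HasSum (fun m => inner ℝ (φ n) (c m • φ m)) (inner ℝ (φ n) x) :=
    h.mapL (innerSL ℝ (φ n))
  rw [real_inner_comm]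
  refine h1.unique ?_
  have h2 : ∀ m, inner ℝ (φ n) (c m • φ m) = if m = n then c n else 0 := by
    intro m
    rw [real_inner_smul_right, orthonormal_iff_ite.1 φ.orthonormal n m]
    by_cases hmn : m = n
    · simp [hmn]
    · simp [hmn, Ne.symm hmn]
  simp only [h2]
  exact hasSum_ite_eq n (c n)

lemma exists_hasSum_basis {c : ℕ → ℝ} (hc : Summable fun n => c n ^ 2) :
    ∃ x : E, HasSum (fun n => c n • φ n) x := by
  have hmem : Memℓp c 2 := (memℓp_gen_iff (by simp)).2 (by simpa using hc)
  exact ⟨_, φ.hasSum_repr_symm ⟨c, hmem⟩⟩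

/-- A coefficientwise comparison of norms. -/
lemma norm_le_of_inner_sq_le {x : E} {a : ℕ → ℝ} {K ρ : ℝ} (hK : 0 ≤ K) (hρ : 0 ≤ ρ)
    (ha : Summable a) (haρ : ∑' n, a n ≤ ρ ^ 2)
    (h : ∀ n, inner ℝ x (φ n) ^ 2 ≤ K ^ 2 * a n) : ‖x‖ ≤ K * ρ := by
  refine le_of_sq_le_sq ?_ (by positivity)
  calc ‖x‖ ^ 2 ≤ K ^ 2 * ∑' n, a n := hasSum_le h (hasSum_inner_sq φ x) (ha.hasSum.mul_left _)
    _ ≤ K ^ 2 * ρ ^ 2 := by gcongr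
    _ = (K * ρ) ^ 2 := by ring

/-- Expansions with continuous coefficients dominated by a square summable sequence are
continuous. -/
lemma continuousOn_of_hasSum_basis {s : Set ℝ} {c : ℕ → ℝ → ℝ} {a : ℕ → ℝ} {v : ℝ → E}
    (hv : ∀ t ∈ s, HasSum (fun n => c n t • φ n) (v t)) (hc : ∀ n, ContinuousOn (c n) s)
    (ha : Summable fun n => a n ^ 2) (hca : ∀ n, ∀ t ∈ s, |c n t| ≤ a n) :
    ContinuousOn v s := by
  intro t ht
  have hco : ∀ r ∈ s, ∑' n, (c n r - c n t) ^ 2 = ‖v r - v t‖ ^ 2 := by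
    intro r hr
    rw [← (hasSum_inner_sq φ (v r - v t)).tsum_eq]
    congr 1
    ext n
    rw [inner_sub_left, inner_of_hasSum φ (hv r hr), inner_of_hasSum φ (hv t ht)]
  -- By Parseval, continuity of `v` is dominated convergence of this series, with majorant `4 a_n²`.
  have hlim : Tendsto (fun r => ∑' n, (c n r - c n t) ^ 2) (𝓝[s] t) (𝓝 (∑' _ : ℕ, (0 : ℝ))) := by
    refine tendsto_tsum_of_dominated_convergence (ha.mul_left 4) (fun n => ?_) ?_
    · have : Tendsto (fun r => (c n r - c n t) ^ 2) (𝓝[s] t) (𝓝 ((c n t - c n t) ^ 2)) :=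
        ((hc n t ht).sub tendsto_const_nhds).pow 2
      simpa using this
    · filter_upwards [self_mem_nhdsWithin] with r hr n
      have h1 := abs_le.1 (hca n r hr)
      have h2 := abs_le.1 (hca n t ht)
      rw [Real.norm_eq_abs, abs_of_nonneg (sq_nonneg _)]
      nlinarith
  have hsq : Tendsto (fun r => ‖v r - v t‖ ^ 2) (𝓝[s] t) (𝓝 0) := by
    rw [tsum_zero] at hlim
    refine hlim.congr' ?_
    filter_upwards [self_mem_nhdsWithin] with r hr using hco r hr
  refine tendsto_iff_norm_sub_tendsto_zero.2 ?_
  have := hsq.sqrt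
  simpa [Real.sqrt_sq (norm_nonneg _)] using this

end Hilbert

/-! ### Scalar bounds for the regularizing filter. -/

section Filter

lemma rpow_le_one_add {y θ : ℝ} (hy : 0 ≤ y) (h0 : 0 ≤ θ) (h1 : θ ≤ 1) : y ^ θ ≤ 1 + y := by
  rcases le_total y 1 with h | h
  · linarith [Real.rpow_le_one hy h h0]
  · have := Real.rpow_le_rpow_of_exponent_le h h1
    rw [Real.rpow_one] at this
    linarith

/-- `λ² / (1 + α λᵇ) ≤ α^{-2/b}`. -/
lemma sq_div_one_add_le {b α lam : ℝ} (hb : 2 ≤ b) (hα : 0 < α) (hl : 0 < lam) :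
    lam ^ 2 / (1 + α * lam ^ b) ≤ 1 / α ^ (2 / b) := by
  have hb0 : 0 < b := by linarith
  have h1 := rpow_le_one_add (y := α * lam ^ b) (θ := 2 / b) (by positivity) (by positivity)
    ((div_le_one hb0).2 hb)
  rw [Real.mul_rpow hα.le (by positivity), ← Real.rpow_mul hl.le, mul_div_cancel₀ _ hb0.ne',
    Real.rpow_two] at h1
  rw [div_le_div_iff₀ (by positivity) (by positivity)]
  linarith

/-- `λ^{b-2} λ² / (1 + α λᵇ) ≤ 1 / α`. -/
lemma rpow_sub_two_mul_le {b α lam : ℝ} (hα : 0 < α) (hl : 0 < lam) :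
    lam ^ (b - 2) * (lam ^ 2 / (1 + α * lam ^ b)) ≤ 1 / α := by
  have h1 : lam ^ (b - 2) * lam ^ 2 = lam ^ b := by
    rw [← Real.rpow_two, ← Real.rpow_add hl]
    congr 1
    ring
  rw [← mul_div_assoc, h1, div_le_div_iff₀ (by positivity) hα]
  linarith

/-- Weighted AM-GM for `1/(1-θ)` and `y/θ` with weights `1-θ` and `θ`, whose mean is `1 + y`.
Equality holds at `y = θ/(1-θ)`; this is the source of the constant in (ii). -/
lemma rpow_le_optimal {y θ : ℝ} (hy : 0 ≤ y) (h0 : 0 < θ) (h1 : θ < 1) :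
    y ^ θ ≤ (1 - θ) * (θ / (1 - θ)) ^ θ * (1 + y) := by
  have h2 : 0 < 1 - θ := by linarith
  have h3 := Real.geom_mean_le_arith_mean2_weighted h2.le h0.le
    (by positivity : 0 ≤ 1 / (1 - θ)) (by positivity : 0 ≤ y / θ) (by ring)
  have h4 : (1 - θ) * (1 / (1 - θ)) + θ * (y / θ) = 1 + y := by field_simp
  rw [h4] at h3
  have h5 : (1 - θ) * (θ / (1 - θ)) ^ θ * ((1 / (1 - θ)) ^ (1 - θ) * (y / θ) ^ θ) = y ^ θ := by
    rw [Real.div_rpow h0.le h2.le, Real.div_rpow hy h0.le, one_div, Real.inv_rpow h2.le,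
      Real.rpow_sub h2, Real.rpow_one]
    field_simp
  rw [← h5]
  gcongr

/-- With `y = α lam^b`, split `y = y^((b-p)/b) * y^(p/b)`. The second factor is `α^(p/b) lam^p`; the
first is controlled by `1 + y`. -/
lemma filter_le_of_lt {b p α lam : ℝ} (hp : 0 < p) (hpb : p < b) (hα : 0 < α) (hl : 0 < lam) :
    α * lam ^ b / (1 + α * lam ^ b)
      ≤ p / b * ((b - p) / p) ^ ((b - p) / b) * α ^ (p / b) * lam ^ p := by
  have hb : 0 < b := hp.trans hpb
  have hbp : 0 < b - p := sub_pos.2 hpb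
  have h1 := rpow_le_optimal (y := α * lam ^ b) (θ := (b - p) / b) (by positivity)
    (by positivity) ((div_lt_one hb).2 (by linarith))
  have h2 : 1 - (b - p) / b = p / b := by field_simp; ring
  have h3 : (b - p) / b / (p / b) = (b - p) / p := by field_simp
  rw [h2, h3] at h1
  have h4 : α * lam ^ b = (α * lam ^ b) ^ ((b - p) / b) * (α ^ (p / b) * lam ^ p) := by
    have h5 : α ^ (p / b) * lam ^ p = (α * lam ^ b) ^ (p / b) := by
      rw [Real.mul_rpow hα.le (by positivity), ← Real.rpow_mul hl.le, mul_div_cancel₀ _ hb.ne']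
    rw [h5, ← Real.rpow_add (by positivity), ← h2, add_sub_cancel, Real.rpow_one]
  rw [div_le_iff₀ (by positivity)]
  calc α * lam ^ b = (α * lam ^ b) ^ ((b - p) / b) * (α ^ (p / b) * lam ^ p) := h4
    _ ≤ p / b * ((b - p) / p) ^ ((b - p) / b) * (1 + α * lam ^ b) * (α ^ (p / b) * lam ^ p) := by
      gcongr
    _ = _ := by ring

lemma filter_le_of_le {b p α lam lam₀ : ℝ} (hpb : b ≤ p) (hα : 0 < α) (hl₀ : 0 < lam₀)
    (hl : lam₀ ≤ lam) :
    α * lam ^ b / (1 + α * lam ^ b) ≤ lam₀ ^ (b - p) * α * lam ^ p := by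
  have hl' : 0 < lam := hl₀.trans_le hl
  calc α * lam ^ b / (1 + α * lam ^ b) ≤ α * lam ^ b :=
        div_le_self (by positivity) (by linarith [(by positivity : 0 ≤ α * lam ^ b)])
    _ = lam ^ (b - p) * α * lam ^ p := by
        rw [mul_right_comm, ← Real.rpow_add hl', sub_add_cancel, mul_comm]
    _ ≤ lam₀ ^ (b - p) * α * lam ^ p := by
        have := Real.rpow_le_rpow_of_nonpos hl₀ hl (sub_nonpos.2 hpb)
        gcongr

end Filter

/-! ### Well-posedness and error estimates. -/

section QuasiReversibility

variable {d : ℕ} {Ω : Set (EuclideanSpace ℝ (Fin d))} {lam : ℕ → ℝ} {φ : HilbertBasis ℕ ℝ (L2 Ω)}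
  {τ : ℝ} {ψ : ℝ → ℝ} {b α : ℝ}

lemma IsQRSource.inner_eq (hτ : 0 < τ) {g f : L2 Ω} (h : IsQRSource lam φ τ ψ b α g f) (n : ℕ) :
    inner ℝ g (φ n) = (1 + α * lam n ^ b) * mu ψ (lam n) τ * inner ℝ f (φ n) := by
  obtain ⟨v, ⟨-, -, hv⟩, rfl⟩ := h
  exact inner_of_hasSum φ (hv τ ⟨hτ.le, le_rfl⟩) n

/-- The cost of inverting `𝕋_α` on one mode; it serves both existence and stability. -/
lemma IsLowerConstant.abs_inner_le {C : ℝ} (hC : IsLowerConstant lam τ ψ C)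
    (hlam : ∀ n, 0 < lam n) (hα : 0 < α) {x y : ℝ} {n : ℕ}
    (h : y = (1 + α * lam n ^ b) * mu ψ (lam n) τ * x) :
    |x| ≤ lam n ^ 2 / (1 + α * lam n ^ b) * (1 / C * |y|) := by
  have hl := hlam n
  have hC0 := hC.1
  have hq : 0 < 1 + α * lam n ^ b := by positivity
  have h1 : (1 + α * lam n ^ b) * (C / lam n ^ 2) * |x| ≤ |y| := by
    rw [h, abs_mul, abs_mul, abs_of_pos hq]
    gcongr
    exact hC.2 n
  calc |x| = lam n ^ 2 / (1 + α * lam n ^ b)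
        * (1 / C * ((1 + α * lam n ^ b) * (C / lam n ^ 2) * |x|)) := by field_simp
    _ ≤ _ := by gcongr

lemma IsLowerConstant.mu_ne_zero {C : ℝ} (hC : IsLowerConstant lam τ ψ C)
    (hlam : ∀ n, 0 < lam n) (n : ℕ) : mu ψ (lam n) τ ≠ 0 := by
  have := hlam n
  have := hC.1
  exact abs_pos.1 (lt_of_lt_of_le (by positivity) (hC.2 n))

/-- The coefficients of `f` are forced to be `c n`, whence uniqueness. For existence,
`rpow_sub_two_mul_le` puts `f` in `ℍ_{b-2}`, exactly what makes the mild solution continuous in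
time. -/
lemma existsUnique_isQRSource (hτ : 0 < τ) (hψ : ContinuousOn ψ (Icc 0 τ))
    (hlam : ∀ n, 0 < lam n) (hmono : Monotone lam) {C : ℝ} (hC : IsLowerConstant lam τ ψ C)
    (hb : 2 ≤ b) (hα : 0 < α) (g : L2 Ω) : ∃! f : L2 Ω, IsQRSource lam φ τ ψ b α g f := by
  have hC0 := hC.1
  have hq : ∀ n, 0 < 1 + α * lam n ^ b := fun n => by
    have := hlam n
    positivity
  have hqm : ∀ n, (1 + α * lam n ^ b) * mu ψ (lam n) τ ≠ 0 := fun n =>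
    mul_ne_zero (hq n).ne' (hC.mu_ne_zero hlam n)
  have hg := (hasSum_inner_sq φ g).summable
  let c : ℕ → ℝ := fun n => inner ℝ g (φ n) / ((1 + α * lam n ^ b) * mu ψ (lam n) τ)
  have hcg : ∀ n, inner ℝ g (φ n) = (1 + α * lam n ^ b) * mu ψ (lam n) τ * c n := fun n =>
    (mul_div_cancel₀ _ (hqm n)).symm
  have hcle : ∀ n, |c n| ≤ lam n ^ 2 / (1 + α * lam n ^ b) * (1 / C * |inner ℝ g (φ n)|) :=
    fun n => hC.abs_inner_le hlam hα (hcg n)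
  have hc2 : Summable fun n => c n ^ 2 := by
    refine Summable.of_nonneg_of_le (fun n => sq_nonneg _) (fun n => ?_)
      (hg.mul_left ((1 / α ^ (2 / b) * (1 / C)) ^ 2))
    rw [← sq_abs, ← sq_abs (inner ℝ g (φ n)), ← mul_pow]
    refine pow_le_pow_left₀ (abs_nonneg _) ((hcle n).trans ?_) 2
    rw [mul_assoc]
    exact mul_le_mul_of_nonneg_right (sq_div_one_add_le hb hα (hlam n)) (by positivity)
  have hcH' : ∀ n, lam n ^ (b - 2) * |c n| ≤ 1 / α * (1 / C) * |inner ℝ g (φ n)| := by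
    intro n
    have := hlam n
    calc lam n ^ (b - 2) * |c n| ≤ lam n ^ (b - 2) *
          (lam n ^ 2 / (1 + α * lam n ^ b) * (1 / C * |inner ℝ g (φ n)|)) := by
            gcongr
            exact hcle n
      _ = (lam n ^ (b - 2) * (lam n ^ 2 / (1 + α * lam n ^ b)))
          * (1 / C * |inner ℝ g (φ n)|) := by ring
      _ ≤ 1 / α * (1 / C * |inner ℝ g (φ n)|) := by
        gcongr
        exact rpow_sub_two_mul_le hα (hlam n)
      _ = _ := by ring
  have hcH : Summable fun n => (lam n ^ (b - 2) * |c n|) ^ 2 := by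
    refine Summable.of_nonneg_of_le (fun n => sq_nonneg _) (fun n => ?_)
      (hg.mul_left ((1 / α * (1 / C)) ^ 2))
    rw [← sq_abs (inner ℝ g (φ n)), ← mul_pow]
    have := hlam n
    exact pow_le_pow_left₀ (by positivity) (hcH' n) 2
  obtain ⟨f, hf⟩ := exists_hasSum_basis φ hc2
  have hfc := inner_of_hasSum φ hf
  obtain ⟨K, hK⟩ := isCompact_Icc.exists_bound_of_continuousOn hψ
  have hK0 : 0 ≤ K := (norm_nonneg _).trans (hK 0 ⟨le_rfl, hτ.le⟩)
  -- The majorant expands `(1 + α λ^b) * K / λ² * |c n|` and replaces `1 / λ_n²` by its value at the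
  -- first eigenvalue.
  let a : ℕ → ℝ := fun n => K * ((1 / lam 0 ^ 2) * |c n| + α * (lam n ^ (b - 2) * |c n|))
  have ha : Summable fun n => a n ^ 2 := by
    refine Summable.of_nonneg_of_le (fun n => sq_nonneg _) (fun n => ?_)
      (((hc2.mul_left ((1 / lam 0 ^ 2) ^ 2)).add (hcH.mul_left (α ^ 2))).mul_left (2 * K ^ 2))
    rw [← sq_abs (c n), ← mul_pow, ← mul_pow, mul_pow K, mul_comm 2, mul_assoc]
    gcongr
    exact add_sq_le
  have hca : ∀ n, ∀ t ∈ Icc 0 τ, |(1 + α * lam n ^ b) * mu ψ (lam n) t * inner ℝ f (φ n)| ≤ a n := by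
    intro n t ht
    have hl := hlam n
    have hl0 := hlam 0
    rw [abs_mul, abs_mul, abs_of_pos (hq n), hfc]
    calc (1 + α * lam n ^ b) * |mu ψ (lam n) t| * |c n|
        ≤ (1 + α * lam n ^ b) * (K / lam n ^ 2) * |c n| := by
          have := hq n
          gcongr
          exact abs_mu_le hl hK ht
      _ = K * ((1 / lam n ^ 2) * |c n| + α * (lam n ^ (b - 2) * |c n|)) := by
          rw [Real.rpow_sub hl, Real.rpow_two]
          ring
      _ ≤ a n := by
          have := hmono (Nat.zero_le n)
          simp only [a]
          gcongr
  have hex : ∀ t ∈ Icc 0 τ, ∃ x : L2 Ω,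
      HasSum (fun n => ((1 + α * lam n ^ b) * mu ψ (lam n) t * inner ℝ f (φ n)) • φ n) x := by
    intro t ht
    refine exists_hasSum_basis φ (Summable.of_nonneg_of_le (fun n => sq_nonneg _) (fun n => ?_) ha)
    rw [← sq_abs]
    exact pow_le_pow_left₀ (abs_nonneg _) (hca n t ht) 2
  choose! v hv using hex
  refine ⟨f, ⟨v, ⟨?_, ?_, hv⟩, ?_⟩, ?_⟩
  · refine hcH.congr fun n => ?_
    rw [hfc, mul_pow, sq_abs, ← Real.rpow_mul_natCast (hlam n).le]
    norm_num [mul_comm]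
  · exact continuousOn_of_hasSum_basis φ hv
      (fun n => (continuousOn_const.mul (continuousOn_mu hτ hψ _)).mul continuousOn_const) ha hca
  · refine eq_of_inner_basis φ fun n => ?_
    rw [inner_of_hasSum φ (hv τ ⟨hτ.le, le_rfl⟩), hfc, hcg]
  · intro f' hf'
    refine eq_of_inner_basis φ fun n => mul_left_cancel₀ (hqm n) ?_
    rw [← hf'.inner_eq hτ n, hfc, hcg]

lemma IsBiparabolicSolution.inner_eq (hτ : 0 < τ) (hψ : ContinuousOn ψ (Icc 0 τ)) {f : L2 Ω}
    {u : ℝ → L2 Ω} (hu : IsBiparabolicSolution Ω τ ψ f u) {l : ℝ} {w : L2 Ω}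
    (hw : IsDirichletEigenfunction Ω l w) :
    inner ℝ (u τ) w = mu ψ l τ * inner ℝ f w := by
  obtain ⟨y₁, h1, h2, h3, h4⟩ := hu.2 l w hw
  exact eq_mul_mu_of_hasDerivWithinAt hτ hψ h1 h2 h3 h4

/-- As `μ_n ≠ 0`, equal final values force `f_n = (1 + α λ_n^b) (f_α)_n`. The filter bound then
trades the factor for the weight `λ_n^p` of the source set. -/
lemma SourceSet.norm_sub_le (hτ : 0 < τ) (hlam : ∀ n, 0 < lam n) {C : ℝ}
    (hC : IsLowerConstant lam τ ψ C) (hα : 0 < α) {ϱ p : ℝ} (hϱ : 0 < ϱ) {f h fα : L2 Ω}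
    (hh : ∀ n, inner ℝ h (φ n) = mu ψ (lam n) τ * inner ℝ f (φ n))
    (hf : f ∈ SourceSet lam φ ϱ p) (hfα : IsQRSource lam φ τ ψ b α h fα) {K : ℝ} (hK : 0 ≤ K)
    (hle : ∀ n, α * lam n ^ b / (1 + α * lam n ^ b) ≤ K * lam n ^ p) :
    ‖f - fα‖ ≤ K * ϱ := by
  refine norm_le_of_inner_sq_le φ hK hϱ.le hf.1 hf.2 fun n => ?_
  have hl := hlam n
  have hq : 0 < 1 + α * lam n ^ b := by positivity
  have h1 : inner ℝ f (φ n) = (1 + α * lam n ^ b) * inner ℝ fα (φ n) := by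
    refine mul_left_cancel₀ (hC.mu_ne_zero hlam n) ?_
    rw [← hh, hfα.inner_eq hτ n]
    ring
  have h2 : inner ℝ (f - fα) (φ n)
      = α * lam n ^ b / (1 + α * lam n ^ b) * inner ℝ f (φ n) := by
    rw [inner_sub_left, h1]
    field_simp
    ring
  have h3 : lam n ^ (2 * p) = (lam n ^ p) ^ 2 := by
    rw [← Real.rpow_mul_natCast hl.le]
    norm_num [mul_comm]
  rw [h2, h3, ← mul_assoc, ← mul_pow, mul_pow (_ / _)]
  exact mul_le_mul_of_nonneg_right (pow_le_pow_left₀ (by positivity) (hle n) 2) (sq_nonneg _)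

lemma IsQRSource.norm_sub_le (hτ : 0 < τ) (hlam : ∀ n, 0 < lam n) {C : ℝ}
    (hC : IsLowerConstant lam τ ψ C) (hb : 2 ≤ b) (hα : 0 < α) {g g' f f' : L2 Ω}
    (hf : IsQRSource lam φ τ ψ b α g f) (hf' : IsQRSource lam φ τ ψ b α g' f') :
    ‖f - f'‖ ≤ 1 / α ^ (2 / b) * (1 / C) * ‖g - g'‖ := by
  have hC0 := hC.1
  have hs := hasSum_inner_sq φ (g - g')
  refine norm_le_of_inner_sq_le φ (by positivity) (norm_nonneg _) hs.summable hs.tsum_eq.le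
    fun n => ?_
  rw [← sq_abs, ← sq_abs (inner ℝ (g - g') (φ n)), ← mul_pow]
  have h1 : inner ℝ (g - g') (φ n)
      = (1 + α * lam n ^ b) * mu ψ (lam n) τ * inner ℝ (f - f') (φ n) := by
    rw [inner_sub_left, inner_sub_left, hf.inner_eq hτ, hf'.inner_eq hτ]
    ring
  refine pow_le_pow_left₀ (abs_nonneg _) ((hC.abs_inner_le hlam hα h1).trans ?_) 2
  rw [mul_assoc]
  exact mul_le_mul_of_nonneg_right (sq_div_one_add_le hb hα (hlam n)) (by positivity)

end QuasiReversibility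

end BiParabolic

theorem theorem4p1 (d : ℕ) (hd : 1 ≤ d) (Ω : Set (EuclideanSpace ℝ (Fin d)))
    (hΩo : IsOpen Ω) (hΩb : Bornology.IsBounded Ω)
    (lam : ℕ → ℝ) (φ : HilbertBasis ℕ ℝ (BiParabolic.L2 Ω))
    (hsys : BiParabolic.IsDirichletEigensystem Ω lam φ)
    (τ : ℝ) (hτ : 0 < τ) (ψ : ℝ → ℝ) (hψ : ContinuousOn ψ (Set.Icc 0 τ))
    (hA : BiParabolic.PsiAssumption τ ψ) :
    -- a constant `C` as required exists
    (∃ C : ℝ, BiParabolic.IsLowerConstant lam τ ψ C) ∧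
    ∀ b α : ℝ, 2 ≤ b → 0 < α →
      -- the regularized solutions are well defined
      (∀ g : BiParabolic.L2 Ω, ∃! f : BiParabolic.L2 Ω,
        BiParabolic.IsQRSource lam φ τ ψ b α g f) ∧
      -- the error estimates
      ∀ C : ℝ, BiParabolic.IsLowerConstant lam τ ψ C →
      ∀ δ ϱ p : ℝ, 0 < δ → 0 < ϱ → 0 < p →
      ∀ (f h hδ : BiParabolic.L2 Ω) (u : ℝ → BiParabolic.L2 Ω),
        BiParabolic.IsBiparabolicSolution Ω τ ψ f u → u τ = h →
        ‖h - hδ‖ ≤ δ →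
        f ∈ BiParabolic.SourceSet lam φ ϱ p →
      ∀ fα fαδ : BiParabolic.L2 Ω,
        BiParabolic.IsQRSource lam φ τ ψ b α h fα →
        BiParabolic.IsQRSource lam φ τ ψ b α hδ fαδ →
        ‖fα - fαδ‖ ≤ 1 / C * (δ / α ^ (2 / b)) ∧
        (p < b → ‖f - fα‖ ≤ p / b * ((b - p) / p) ^ ((b - p) / b) * ϱ * α ^ (p / b)) ∧
        (b ≤ p → ‖f - fα‖ ≤ lam 0 ^ (b - p) * ϱ * α) := by
  have hlam : ∀ n, 0 < lam n := fun n => (hsys.2 n).pos hd hΩb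
  have hex : ∃ C : ℝ, BiParabolic.IsLowerConstant lam τ ψ C := by
    obtain ⟨C, hC, hle⟩ := hA.exists_lower hψ (hlam 0)
    exact ⟨C, hC, fun n => hle _ (hsys.1 (Nat.zero_le n))⟩
  refine ⟨hex, fun b α hb hα => ⟨fun g => ?_, ?_⟩⟩
  · obtain ⟨C, hC⟩ := hex
    exact BiParabolic.existsUnique_isQRSource hτ hψ hlam hsys.1 hC hb hα g
  · intro C hC δ ϱ p _ hϱ hp f h hδ u hu huh hhδ hf fα fαδ hfα hfαδ
    have hC0 := hC.1
    have hh : ∀ n, inner ℝ h (φ n) = BiParabolic.mu ψ (lam n) τ * inner ℝ f (φ n) := fun n =>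
      huh ▸ hu.inner_eq hτ hψ (hsys.2 n)
    refine ⟨?_, fun hpb => ?_, fun hpb => ?_⟩
    · calc ‖fα - fαδ‖ ≤ 1 / α ^ (2 / b) * (1 / C) * ‖h - hδ‖ :=
            hfα.norm_sub_le hτ hlam hC hb hα hfαδ
        _ ≤ 1 / α ^ (2 / b) * (1 / C) * δ := by gcongr
        _ = 1 / C * (δ / α ^ (2 / b)) := by ring
    · have hb0 : 0 < b := hp.trans hpb
      have hbp : 0 < b - p := sub_pos.2 hpb
      rw [mul_right_comm]
      exact BiParabolic.SourceSet.norm_sub_le hτ hlam hC hα hϱ hh hf hfα (by positivity)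
        fun n => BiParabolic.filter_le_of_lt hp hpb hα (hlam n)
    · have hl0 := hlam 0
      rw [mul_right_comm]
      exact BiParabolic.SourceSet.norm_sub_le hτ hlam hC hα hϱ hh hf hfα (by positivity)
        fun n => BiParabolic.filter_le_of_le hpb hα hl0 (hsys.1 (Nat.zero_le n))
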